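/- Let $$K_1=\left\{ \sum_{n=1}^{\infty} \frac{\varepsilon_n}{4^n} : \varepsilon_n\in \{0, 2, 3, 5\} \text{ for every } n\ge 1 \right\}\subset\mathbb{R}$$ be the Guthrie–Nymann Cantorval. Then $K_1$ has Lebesgue measure $1$, and its topological boundary in $\mathbb{R}$ has Hausdorff dimension equal to $\log 3/\log 4$. In particular, the boundary is a fractal set, in the sense that its Hausdorff dimension is not an integer. -/

import Mathlib

/-- The set `K₁` of all sums `∑_{n ≥ 1} ε_n / 4 ^ n` with digits `ε_n ∈ {0, 2, 3, 5}`. The digit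
`ε_n` is stored at index `n - 1`; the series always converges, as the digits are bounded. -/
def guthrieNymann : Set ℝ :=
  {x : ℝ | ∃ ε : ℕ → ℝ, (∀ n, ε n ∈ ({0, 2, 3, 5} : Set ℝ)) ∧
    HasSum (fun n : ℕ => ε n / (4 : ℝ) ^ (n + 1)) x}

open MeasureTheory Filter Topology Set
open scoped ENNReal NNReal Pointwise

/-! Write K for the set and C for `digitSums {0, 1, 2}`. The digits 0, 2, 3, 5 represent all
residues mod 4, so the integer translates of K cover ℝ (`exists_sub_intCast_mem_guthrieNymann`).
Comparing digits gives K ∩ (K - 1) = C (`mem_cantor_iff`), and C has dimension s = log 3 / log 4 <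
1, hence is null. So K tiles ℝ by integer translates up to null sets and has measure 1. A point of K
off C ∪ (C + 1) is interior, since no other translate can cover its neighbours. Conversely, an
interior point of K in C would make the overlap K ∩ (K - 1) of positive measure. So the boundary
lies between C and C ∪ (C + 1), and its dimension is s, strictly between 0 and 1. -/

/-! ### Digit sums in base 4 -/

/-- The sums `∑_{n ≥ 1} ε_n / 4 ^ n` with digits `ε_n ∈ D`. -/
def digitSums (D : Set ℝ) : Set ℝ :=
  {x : ℝ | ∃ ε : ℕ → ℝ, (∀ n, ε n ∈ D) ∧ HasSum (fun n : ℕ => ε n / (4 : ℝ) ^ (n + 1)) x}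

theorem exists_of_mem_digitSums {D : Set ℝ} {x : ℝ} (hx : x ∈ digitSums D) :
    ∃ d ∈ D, 4 * x - d ∈ digitSums D := by
  obtain ⟨ε, hε, hs⟩ := hx
  refine ⟨ε 0, hε 0, fun n => ε (n + 1), fun n => hε _, ?_⟩
  have h := ((hasSum_nat_add_iff' 1).mpr hs).mul_left 4
  have h1 : ∀ n : ℕ, 4 * (ε (n + 1) / (4 : ℝ) ^ (n + 1 + 1)) = ε (n + 1) / 4 ^ (n + 1) := fun n => by
    rw [pow_succ _ (n + 1)]
    field_simp
  have h2 : 4 * (x - ∑ i ∈ Finset.range 1, ε i / (4 : ℝ) ^ (i + 1)) = 4 * x - ε 0 := by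
    simp
    ring
  simpa only [h1, h2] using h

/-- Coinduction principle: iterating `4 * y - d y` inside `S` produces the digits, and boundedness
makes the remainder after `n` digits O(4⁻ⁿ). -/
theorem mem_digitSums_of_bounded {D S : Set ℝ} {M : ℝ} (hM : ∀ x ∈ S, |x| ≤ M)
    (hS : ∀ x ∈ S, ∃ d ∈ D, 4 * x - d ∈ S) : S ⊆ digitSums D := by
  intro x hx
  choose! d hd hf using hS
  set f : ℕ → ℝ := fun n => (fun y => 4 * y - d y)^[n] x with hfdef
  have hsucc : ∀ n, f (n + 1) = 4 * f n - d (f n) := fun n => by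
    simp only [hfdef, Function.iterate_succ_apply']
  have hfS : ∀ n, f n ∈ S := by
    intro n
    induction n with
    | zero => exact hx
    | succ n ih => rw [hsucc]; exact hf _ ih
  refine ⟨fun n => d (f n), fun n => hd _ (hfS n), ?_⟩
  have hM0 : 0 ≤ M := (abs_nonneg x).trans (hM x hx)
  have hgeo : Tendsto (fun n : ℕ => ((1 : ℝ) / 4) ^ n) atTop (𝓝 0) :=
    tendsto_pow_atTop_nhds_zero_of_lt_one (by norm_num) (by norm_num)
  have hsum : Summable fun n : ℕ => ‖d (f n) / (4 : ℝ) ^ (n + 1)‖ := by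
    refine Summable.of_nonneg_of_le (fun n => norm_nonneg _) (fun n => ?_)
      ((summable_geometric_of_lt_one (r := (1 : ℝ) / 4) (by norm_num) (by norm_num)).mul_left
        (5 * M / 4))
    have h1 := abs_le.mp (hM _ (hfS n))
    have h2 := abs_le.mp (hM _ (hfS (n + 1)))
    rw [hsucc] at h2
    have h3 : |d (f n)| ≤ 5 * M := abs_le.mpr ⟨by linarith, by linarith⟩
    rw [norm_div, Real.norm_eq_abs, norm_pow, Real.norm_of_nonneg (by norm_num : (0 : ℝ) ≤ 4)]
    rw [one_div_pow, pow_succ, div_mul_div_comm, mul_one, mul_comm (4 : ℝ)]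
    gcongr
  rw [hasSum_iff_tendsto_nat_of_summable_norm hsum]
  have hpart : ∀ n : ℕ, ∑ i ∈ Finset.range n, d (f i) / (4 : ℝ) ^ (i + 1) =
      x - f n * (1 / 4) ^ n := by
    intro n
    induction n with
    | zero => simp [hfdef]
    | succ n ih =>
      rw [Finset.sum_range_succ, ih, hsucc, one_div_pow, one_div_pow, pow_succ]
      field_simp
      ring
  simp_rw [hpart]
  have : Tendsto (fun n => f n * (1 / 4 : ℝ) ^ n) atTop (𝓝 0) := by
    refine squeeze_zero_norm (fun n => ?_) (by simpa only [mul_zero] using hgeo.const_mul M)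
    rw [norm_mul, norm_pow, Real.norm_of_nonneg (by norm_num : (0 : ℝ) ≤ 1 / 4)]
    exact mul_le_mul_of_nonneg_right (hM _ (hfS n)) (by positivity)
  simpa using this.const_sub x

theorem digitSums_subset_Icc {D : Set ℝ} {M : ℝ} (hD : D ⊆ Icc 0 M) :
    digitSums D ⊆ Icc 0 (M / 3) := by
  rintro x ⟨ε, hε, hs⟩
  have hgeo : HasSum (fun n : ℕ => M / (4 : ℝ) ^ (n + 1)) (M / 3) := by
    have := (hasSum_geometric_of_lt_one (r := (1 : ℝ) / 4) (by norm_num) (by norm_num)).mul_left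
      (M / 4)
    have h1 : ∀ n : ℕ, M / 4 * (1 / 4 : ℝ) ^ n = M / 4 ^ (n + 1) := fun n => by
      rw [one_div_pow, pow_succ, div_mul_div_comm, mul_one, mul_comm (4 : ℝ)]
    have h2 : M / 4 * (1 - 1 / 4 : ℝ)⁻¹ = M / 3 := by norm_num; ring
    simpa only [h1, h2] using this
  refine ⟨hs.nonneg fun n => div_nonneg (hD (hε n)).1 (by positivity),
    hasSum_le (fun n => ?_) hs hgeo⟩
  have := (hD (hε n)).2
  gcongr

theorem abs_le_of_mem_digitSums {D : Set ℝ} {M x : ℝ} (hD : D ⊆ Icc 0 M) (hx : x ∈ digitSums D) :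
    |x| ≤ M / 3 := by
  have := digitSums_subset_Icc hD hx
  rw [abs_of_nonneg this.1]
  exact this.2

theorem mem_digitSums_iff {D : Set ℝ} {M x : ℝ} (hD : D ⊆ Icc 0 M) :
    x ∈ digitSums D ↔ ∃ d ∈ D, 4 * x - d ∈ digitSums D := by
  refine ⟨exists_of_mem_digitSums, fun h => ?_⟩
  refine mem_digitSums_of_bounded (S := insert x (digitSums D)) (M := max |x| (M / 3)) ?_ ?_
    (mem_insert _ _)
  · rintro y (rfl | hy)
    · exact le_max_left _ _
    · exact (abs_le_of_mem_digitSums hD hy).trans (le_max_right _ _)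
  · rintro y (rfl | hy)
    · obtain ⟨d, hd, h⟩ := h
      exact ⟨d, hd, mem_insert_of_mem _ h⟩
    · obtain ⟨d, hd, h⟩ := exists_of_mem_digitSums hy
      exact ⟨d, hd, mem_insert_of_mem _ h⟩

/-- For finite `D` the closure inherits the digit-removal property, so coinduction applies to it. -/
theorem isClosed_digitSums {D : Set ℝ} {M : ℝ} (hfin : D.Finite) (hD : D ⊆ Icc 0 M) :
    IsClosed (digitSums D) := by
  refine isClosed_of_closure_subset (mem_digitSums_of_bounded (M := M / 3) ?_ ?_)
  · intro x hx
    have := closure_minimal (digitSums_subset_Icc hD) isClosed_Icc hx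
    rw [abs_of_nonneg this.1]
    exact this.2
  · have hcl : IsClosed (⋃ d ∈ D, (fun x : ℝ => 4 * x - d) ⁻¹' closure (digitSums D)) :=
      hfin.isClosed_biUnion fun d _ => isClosed_closure.preimage (by fun_prop)
    intro x hx
    have := closure_minimal (fun y hy => ?_) hcl hx
    · simpa using this
    · obtain ⟨d, hd, h⟩ := exists_of_mem_digitSums hy
      exact mem_biUnion hd (subset_closure h)

/-! ### Overlaps and integer translates of K -/

theorem gnDigits_subset : ({0, 2, 3, 5} : Set ℝ) ⊆ Icc 0 5 := by
  rintro x (rfl | rfl | rfl | rfl) <;> norm_num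

theorem cantorDigits_subset : ({0, 1, 2} : Set ℝ) ⊆ Icc 0 2 := by
  rintro x (rfl | rfl | rfl) <;> norm_num

theorem guthrieNymann_subset_Icc : guthrieNymann ⊆ Icc 0 (5 / 3) :=
  digitSums_subset_Icc gnDigits_subset

theorem mem_guthrieNymann_iff {x : ℝ} :
    x ∈ guthrieNymann ↔ ∃ d ∈ ({0, 2, 3, 5} : Set ℝ), 4 * x - d ∈ guthrieNymann :=
  mem_digitSums_iff gnDigits_subset

theorem isClosed_guthrieNymann : IsClosed guthrieNymann :=
  isClosed_digitSums (by simp) gnDigits_subset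

theorem isCompact_guthrieNymann : IsCompact guthrieNymann :=
  isCompact_Icc.of_isClosed_subset isClosed_guthrieNymann guthrieNymann_subset_Icc

/-- Both directions are coinductive: C ∪ (C + 1) is stable under removing a digit of K, and K ∩ (K -
1) under removing a digit of C. -/
theorem mem_cantor_iff {x : ℝ} :
    x ∈ digitSums {0, 1, 2} ↔ x ∈ guthrieNymann ∧ x + 1 ∈ guthrieNymann := by
  constructor
  · have key : digitSums {0, 1, 2} ∪ {y | y - 1 ∈ digitSums {0, 1, 2}} ⊆ guthrieNymann := by
      refine mem_digitSums_of_bounded (M := 5 / 3) ?_ ?_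
      · rintro y (hy | hy) <;> have := digitSums_subset_Icc cantorDigits_subset hy <;>
          refine abs_le.mpr ⟨?_, ?_⟩ <;> linarith [this.1, this.2]
      · rintro y (hy | hy) <;> obtain ⟨d, hd, h⟩ := exists_of_mem_digitSums hy <;>
          rcases hd with rfl | rfl | rfl
        · exact ⟨0, by simp, Or.inl h⟩
        · exact ⟨0, by simp, Or.inr (by simpa using h)⟩
        · exact ⟨2, by simp, Or.inl h⟩
        · exact ⟨3, by simp, Or.inr (mem_of_eq_of_mem (s := digitSums {0, 1, 2}) (y := 4 * (y - 1) - 0) (by ring) h)⟩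
        · exact ⟨5, by simp, Or.inl (mem_of_eq_of_mem (by ring) h)⟩
        · exact ⟨5, by simp, Or.inr (mem_of_eq_of_mem (s := digitSums {0, 1, 2}) (y := 4 * (y - 1) - 2) (by ring) h)⟩
    exact fun h => ⟨key (Or.inl h), key (Or.inr (by simpa using h))⟩
  · intro h
    refine mem_digitSums_of_bounded (S := {y | y ∈ guthrieNymann ∧ y + 1 ∈ guthrieNymann})
      (M := 5 / 3) (fun y hy => abs_le_of_mem_digitSums gnDigits_subset hy.1) ?_ h
    rintro y ⟨hy, hy1⟩
    obtain ⟨d', hd', hz⟩ := exists_of_mem_digitSums hy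
    obtain ⟨d, hd, hw⟩ := exists_of_mem_digitSums hy1
    have hz' := guthrieNymann_subset_Icc hz
    have hw' := guthrieNymann_subset_Icc hw
    -- The new remainders differ by 4 + d' - d, which must lie in [-5/3, 5/3]. Only (d', d) = (0,
    -- 3), (0, 5), (2, 5) survive; the difference is then ±1, and the digits of C are 0, 1, 2.
    have h1 : -(5 / 3) ≤ 4 + d' - d := by linarith [hz'.2, hw'.1]
    have h2 : 4 + d' - d ≤ 5 / 3 := by linarith [hz'.1, hw'.2]
    rcases hd with rfl | rfl | rfl | rfl <;> rcases hd' with rfl | rfl | rfl | rfl <;>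
      try (exfalso; linarith)
    · exact ⟨0, by simp, hz, mem_of_eq_of_mem (by ring) hw⟩
    · exact ⟨1, by simp, mem_of_eq_of_mem (by ring) hw,
        mem_of_eq_of_mem (by ring) hz⟩
    · exact ⟨2, by simp, hz, mem_of_eq_of_mem (by ring) hw⟩

/-- ℤ + K is closed and stable under division by 4, so it contains the dense set of all m / 4ⁿ. -/
theorem exists_sub_intCast_mem_guthrieNymann (x : ℝ) : ∃ j : ℤ, x - j ∈ guthrieNymann := by
  set N : Set ℝ := range ((↑) : ℤ → ℝ) + guthrieNymann with hN
  have hcl : IsClosed N :=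
    Int.isClosedEmbedding_coe_real.isClosed_range.add_right_of_isCompact isCompact_guthrieNymann
  have hmem : ∀ y, y ∈ N ↔ ∃ j : ℤ, y - j ∈ guthrieNymann := by
    intro y
    constructor
    · rintro ⟨_, ⟨j, rfl⟩, k, hk, rfl⟩
      exact ⟨j, by simpa using hk⟩
    · rintro ⟨j, hj⟩
      exact ⟨j, ⟨j, rfl⟩, _, hj, by simp⟩
  have hdiv : ∀ y, 4 * y ∈ N → y ∈ N := by
    intro y hy
    obtain ⟨j, hj⟩ := (hmem _).1 hy
    have aux : ∀ m : ℤ, ∀ d ∈ ({0, 2, 3, 5} : Set ℝ), (j : ℝ) = 4 * m + d → y ∈ N := by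
      intro m d hd h
      refine (hmem _).2 ⟨m, mem_guthrieNymann_iff.2 ⟨d, hd, ?_⟩⟩
      convert hj using 1
      rw [h]; ring
    -- The digit 5 stands for the residue 1.
    have : j = 4 * (j / 4) + 0 ∨ j = 4 * (j / 4 - 1) + 5 ∨ j = 4 * (j / 4) + 2 ∨
      j = 4 * (j / 4) + 3 := by omega
    rcases this with h | h | h | h
    · exact aux (j / 4) 0 (by simp) (by exact_mod_cast h)
    · exact aux (j / 4 - 1) 5 (by simp) (by exact_mod_cast h)
    · exact aux (j / 4) 2 (by simp) (by exact_mod_cast h)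
    · exact aux (j / 4) 3 (by simp) (by exact_mod_cast h)
  have h0 : (0 : ℝ) ∈ guthrieNymann := ⟨fun _ => 0, by simp, by simp [hasSum_zero]⟩
  have hq : ∀ n : ℕ, ∀ m : ℤ, (m : ℝ) / 4 ^ n ∈ N := by
    intro n
    induction n with
    | zero => exact fun m => (hmem _).2 ⟨m, by simpa using h0⟩
    | succ n ih =>
      refine fun m => hdiv _ ?_
      convert ih m using 1
      rw [pow_succ]; field_simp
  refine (hmem x).1 (hcl.mem_of_tendsto (f := fun n : ℕ => (⌊x * 4 ^ n⌋ : ℝ) / 4 ^ n)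
    (b := atTop) ?_ (Eventually.of_forall fun n => hq n _))
  have hgeo : Tendsto (fun n : ℕ => x - ((1 : ℝ) / 4) ^ n) atTop (𝓝 x) := by
    simpa using (tendsto_pow_atTop_nhds_zero_of_lt_one (by norm_num : (0 : ℝ) ≤ 1 / 4)
      (by norm_num)).const_sub x
  refine tendsto_of_tendsto_of_tendsto_of_le_of_le hgeo tendsto_const_nhds (fun n => ?_) (fun n => ?_)
  · have := Int.lt_floor_add_one (x * 4 ^ n)
    rw [one_div_pow]
    field_simp
    linarith
  · have := Int.floor_le (x * 4 ^ n)
    field_simp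
    linarith

/-! ### Hausdorff dimension of C -/

/-- The base `4` expansion with digits in `{0, 1, 2}`. -/
noncomputable def cantorMap (a : ℕ → Fin 3) : ℝ := Real.ofDigits fun i => (a i).castSucc

theorem range_cantorMap : range cantorMap = digitSums {0, 1, 2} := by
  have hterm : ∀ (a : ℕ → Fin 3) (n : ℕ),
      Real.ofDigitsTerm (fun i => (a i).castSucc) n = ((a n : ℕ) : ℝ) / (4 : ℝ) ^ (n + 1) := by
    intro a n
    simp [Real.ofDigitsTerm, div_eq_mul_inv]
  ext x
  constructor
  · rintro ⟨a, rfl⟩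
    refine ⟨fun n => ((a n : ℕ) : ℝ), fun n => ?_, ?_⟩
    · have : ∀ k : Fin 3, ((k : ℕ) : ℝ) ∈ ({0, 1, 2} : Set ℝ) := by
        intro k
        fin_cases k <;> simp
      exact this (a n)
    · simp_rw [← hterm]
      exact Real.summable_ofDigitsTerm.hasSum
  · rintro ⟨ε, hε, hs⟩
    have : ∀ n, ∃ k : Fin 3, ε n = ((k : ℕ) : ℝ) := by
      intro n
      rcases hε n with h | h | h
      · exact ⟨0, by simp [h]⟩
      · exact ⟨1, by simp [h]⟩
      · exact ⟨2, by rw [h]; simp⟩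
    choose a ha using this
    refine ⟨a, ?_⟩
    simp_rw [ha, ← hterm] at hs
    exact hs.tsum_eq

theorem cantorMap_le (a : ℕ → Fin 3) : cantorMap a ≤ 2 / 3 := by
  have hgeo : HasSum (fun n : ℕ => 2 * ((4 : ℝ) ^ (n + 1))⁻¹) (2 / 3) := by
    have := (hasSum_geometric_of_lt_one (r := (1 : ℝ) / 4) (by norm_num) (by norm_num)).mul_left
      (1 / 2)
    have h1 : ∀ n : ℕ, 1 / 2 * (1 / 4 : ℝ) ^ n = 2 * ((4 : ℝ) ^ (n + 1))⁻¹ := fun n => by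
      rw [one_div_pow, pow_succ, mul_inv]
      ring
    have h2 : 1 / 2 * (1 - 1 / 4 : ℝ)⁻¹ = 2 / 3 := by norm_num
    simpa only [h1, h2] using this
  refine hasSum_le (fun n => ?_) Real.summable_ofDigitsTerm.hasSum hgeo
  have : ((a n : ℕ) : ℝ) ≤ 2 := by exact_mod_cast Nat.lt_succ_iff.1 (a n).2
  have h4 : ((3 + 1 : ℕ) : ℝ) = 4 := by norm_num
  simp only [Real.ofDigitsTerm, Fin.val_castSucc, h4]
  gcongr

/-- The number with given first `n` base `4` digits in `{0, 1, 2}`. -/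
noncomputable def cantorPrefix {n : ℕ} (w : Fin n → Fin 3) : ℝ := ∑ i, ((w i : ℕ) : ℝ) * ((4 : ℝ) ^ (i.1 + 1))⁻¹

theorem cantorMap_eq_prefix_add (a : ℕ → Fin 3) (n : ℕ) :
    cantorMap a = cantorPrefix (fun i : Fin n => a i) +
      ((4 : ℝ) ^ n)⁻¹ * cantorMap fun i => a (i + n) := by
  rw [cantorMap, Real.ofDigits_eq_sum_add_ofDigits _ n, Finset.sum_range]
  simp [cantorPrefix, Real.ofDigitsTerm, cantorMap]

theorem cantorMap_nonneg (a : ℕ → Fin 3) : 0 ≤ cantorMap a := Real.ofDigits_nonneg _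

/-- At the first differing digit the gap is at least 1/4 and the tails offset at most (2/3)/4,
leaving 1/12. -/
theorem le_abs_cantorMap_sub {a b : ℕ → Fin 3} {n : ℕ} (h : ∀ i < n, a i = b i) (hn : a n ≠ b n) :
    ((4 : ℝ) ^ n)⁻¹ / 12 ≤ |cantorMap a - cantorMap b| := by
  have hp : (fun i : Fin n => a i) = fun i : Fin n => b i := funext fun i => h i i.2
  have h1 : ∀ c : ℕ → Fin 3, cantorMap (fun i => c (i + n)) =
      ((c n : ℕ) : ℝ) / 4 + cantorMap (fun i => c (i + 1 + n)) / 4 := fun c => by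
    rw [cantorMap_eq_prefix_add _ 1]
    simp [cantorPrefix]
    ring
  rw [cantorMap_eq_prefix_add a n, cantorMap_eq_prefix_add b n, hp, add_sub_add_left_eq_sub,
    ← mul_sub, abs_mul, abs_of_nonneg (by positivity), div_eq_mul_inv]
  refine mul_le_mul_of_nonneg_left ?_ (by positivity)
  rw [h1, h1]
  have a0 := cantorMap_nonneg fun i => a (i + 1 + n)
  have a1 := cantorMap_le fun i => a (i + 1 + n)
  have b0 := cantorMap_nonneg fun i => b (i + 1 + n)
  have b1 := cantorMap_le fun i => b (i + 1 + n)
  rcases lt_or_gt_of_ne hn with hlt | hlt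
  · have : ((a n : ℕ) : ℝ) + 1 ≤ ((b n : ℕ) : ℝ) := by exact_mod_cast hlt
    refine le_abs.mpr (Or.inr ?_)
    norm_num
    linarith
  · have : ((b n : ℕ) : ℝ) + 1 ≤ ((a n : ℕ) : ℝ) := by exact_mod_cast hlt
    refine le_abs.mpr (Or.inl ?_)
    norm_num
    linarith

/-- The dimension `log 3 / log 4`. -/
noncomputable def cantorDim : ℝ≥0 := ⟨Real.log 3 / Real.log 4, div_nonneg (Real.log_nonneg (by norm_num))
  (Real.log_nonneg (by norm_num))⟩

theorem cantorDim_pos : 0 < cantorDim := by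
  change 0 < Real.log 3 / Real.log 4
  exact div_pos (Real.log_pos (by norm_num)) (Real.log_pos (by norm_num))

theorem cantorDim_lt_one : cantorDim < 1 := by
  change Real.log 3 / Real.log 4 < 1
  rw [div_lt_one (Real.log_pos (by norm_num))]
  exact Real.log_lt_log (by norm_num) (by norm_num)

theorem four_rpow_cantorDim : (4 : ℝ) ^ (cantorDim : ℝ) = 3 := by
  change (4 : ℝ) ^ (Real.log 3 / Real.log 4) = 3
  rw [Real.rpow_def_of_pos (by norm_num), mul_div_cancel₀ _ (Real.log_pos (by norm_num)).ne',
    Real.exp_log (by norm_num)]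

theorem inv_four_pow_rpow_cantorDim (n : ℕ) :
    (((4 : ℝ) ^ n)⁻¹) ^ (cantorDim : ℝ) = ((3 : ℝ) ^ n)⁻¹ := by
  rw [Real.inv_rpow (by positivity), ← Real.rpow_natCast, ← Real.rpow_mul (by norm_num), mul_comm,
    Real.rpow_mul (by norm_num), four_rpow_cantorDim, Real.rpow_natCast]

/-- Rereading base 4 digits in base 3 is Hölder of exponent s, because (4⁻ⁿ)ˢ = 3⁻ⁿ. -/
theorem abs_ofDigits_sub_le (a b : ℕ → Fin 3) :
    |Real.ofDigits a - Real.ofDigits b| ≤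
      12 * |cantorMap a - cantorMap b| ^ (cantorDim : ℝ) := by
  by_cases hab : a = b
  · subst hab
    simp only [sub_self, abs_zero]
    positivity
  · obtain ⟨n, hn, hmin⟩ : ∃ n, a n ≠ b n ∧ ∀ i < n, a i = b i := by
      have hex : ∃ n, a n ≠ b n := Function.ne_iff.1 hab
      exact ⟨Nat.find hex, Nat.find_spec hex, fun i hi => not_not.1 (Nat.find_min hex hi)⟩
    calc |Real.ofDigits a - Real.ofDigits b| ≤ ((3 : ℝ) ^ n)⁻¹ := by
          simpa using Real.abs_ofDigits_sub_ofDigits_le hmin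
      _ = (((4 : ℝ) ^ n)⁻¹ / 12) ^ (cantorDim : ℝ) * 12 ^ (cantorDim : ℝ) := by
          rw [← Real.mul_rpow (by positivity) (by norm_num), div_mul_cancel₀ _ (by norm_num),
            inv_four_pow_rpow_cantorDim]
      _ ≤ |cantorMap a - cantorMap b| ^ (cantorDim : ℝ) * 12 := by
          gcongr
          · exact le_abs_cantorMap_sub hmin hn
          · simpa using Real.rpow_le_rpow_of_exponent_le (x := 12) (by norm_num)
              (NNReal.coe_le_coe.2 cantorDim_lt_one.le)
      _ = _ := mul_comm _ _

/-- The Hölder map sends C onto [0, 1], whence 1 ≤ dim C / s. -/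
theorem le_dimH_range_cantorMap : (cantorDim : ℝ≥0∞) ≤ dimH (range cantorMap) := by
  set f : ℝ → ℝ := fun x => Real.ofDigits (Function.invFun cantorMap x) with hf
  have hinv : ∀ a, cantorMap (Function.invFun cantorMap (cantorMap a)) = cantorMap a := fun a =>
    Function.invFun_eq ⟨a, rfl⟩
  have hfa : ∀ a, f (cantorMap a) = Real.ofDigits a := by
    intro a
    -- The Hölder bound at distance 0 shows that the chosen preimage is immaterial.
    have := abs_ofDigits_sub_le (Function.invFun cantorMap (cantorMap a)) a
    rw [hinv, sub_self, abs_zero, Real.zero_rpow (NNReal.coe_ne_zero.2 cantorDim_pos.ne'),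
      mul_zero] at this
    exact sub_eq_zero.1 (abs_nonpos_iff.1 this)
  have hH : HolderOnWith 12 cantorDim f (range cantorMap) := by
    rintro _ ⟨a, rfl⟩ _ ⟨b, rfl⟩
    rw [hfa, hfa, edist_dist, edist_dist, Real.dist_eq, Real.dist_eq,
      ENNReal.ofReal_rpow_of_nonneg (abs_nonneg _) cantorDim.coe_nonneg]
    have h12 : ((12 : ℝ≥0) : ℝ≥0∞) = ENNReal.ofReal 12 := by simp
    rw [h12, ← ENNReal.ofReal_mul (by norm_num)]
    exact ENNReal.ofReal_le_ofReal (abs_ofDigits_sub_le a b)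
  have himg : Icc (0 : ℝ) 1 ⊆ f '' range cantorMap := by
    intro y hy
    obtain ⟨a, -, rfl⟩ := Real.ofDigits_SurjOn (b := 3) (by norm_num) hy
    exact ⟨_, ⟨a, rfl⟩, hfa a⟩
  have h1 : dimH (Icc (0 : ℝ) 1) = 1 := by
    rw [Real.dimH_of_mem_nhds (Icc_mem_nhds (a := (0 : ℝ)) (x := 1 / 2) (by norm_num) (by norm_num))]
    simp
  have := (h1 ▸ dimH_mono himg).trans (hH.dimH_image_le cantorDim_pos)
  have h2 := (ENNReal.le_div_iff_mul_le (Or.inl (by simpa using cantorDim_pos.ne'))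
    (Or.inl ENNReal.coe_ne_top)).1 this
  simpa using h2

/-- The 3ⁿ intervals of length 4⁻ⁿ have s-powers summing to exactly 1, so the s-dimensional measure
is at most 1. -/
theorem dimH_range_cantorMap_le : dimH (range cantorMap) ≤ cantorDim := by
  have hdiam : ∀ (n : ℕ) (w : Fin n → Fin 3),
      Metric.ediam (Icc (cantorPrefix w) (cantorPrefix w + ((4 : ℝ) ^ n)⁻¹)) =
        ENNReal.ofReal ((4 : ℝ) ^ n)⁻¹ := by
    intro n w
    rw [Real.ediam_Icc]
    simp
  refine dimH_le_of_hausdorffMeasure_ne_top (ne_top_of_le_ne_top ENNReal.one_ne_top ?_)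
  refine (Measure.hausdorffMeasure_le_liminf_sum (ι := fun n : ℕ => Fin n → Fin 3) (l := atTop) _ _
    (fun n => ENNReal.ofReal ((4 : ℝ) ^ n)⁻¹) ?_
    (fun n w => Icc (cantorPrefix w) (cantorPrefix w + ((4 : ℝ) ^ n)⁻¹))
    (Eventually.of_forall fun n w => (hdiam n w).le) (Eventually.of_forall fun n => ?_)).trans ?_
  · have := tendsto_pow_atTop_nhds_zero_of_lt_one (by norm_num : (0 : ℝ) ≤ 4⁻¹) (by norm_num)
    simpa only [inv_pow, ENNReal.ofReal_zero] using ENNReal.tendsto_ofReal this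
  · rintro _ ⟨a, rfl⟩
    refine mem_iUnion.2 ⟨fun i => a i, ?_⟩
    have h0 := cantorMap_nonneg fun i => a (i + n)
    have h1 := cantorMap_le fun i => a (i + n)
    have h4 : 0 < ((4 : ℝ) ^ n)⁻¹ := by positivity
    rw [cantorMap_eq_prefix_add a n]
    constructor <;> nlinarith
  · have hone : ∀ n : ℕ, ∑ w : Fin n → Fin 3,
        Metric.ediam (Icc (cantorPrefix w) (cantorPrefix w + ((4 : ℝ) ^ n)⁻¹)) ^ (cantorDim : ℝ) =
          1 := by
      intro n
      simp_rw [hdiam, ENNReal.ofReal_rpow_of_nonneg (by positivity : (0 : ℝ) ≤ (4 ^ n)⁻¹)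
        cantorDim.coe_nonneg, inv_four_pow_rpow_cantorDim]
      rw [Finset.sum_const, nsmul_eq_mul, Finset.card_univ, Fintype.card_fun, Fintype.card_fin,
        Fintype.card_fin, ← ENNReal.ofReal_natCast, ← ENNReal.ofReal_mul (by positivity)]
      rw [Nat.cast_pow, Nat.cast_ofNat]
      rw [mul_inv_cancel₀ (by positivity), ENNReal.ofReal_one]
    simp_rw [hone]
    simp

theorem dimH_cantor : dimH (digitSums {0, 1, 2}) = cantorDim := by
  rw [← range_cantorMap]
  exact le_antisymm dimH_range_cantorMap_le le_dimH_range_cantorMap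

theorem volume_cantor : volume (digitSums {0, 1, 2}) = 0 := by
  rw [← hausdorffMeasure_real]
  have : dimH (digitSums {0, 1, 2}) < (1 : ℝ≥0) := by
    rw [dimH_cantor]
    exact_mod_cast cantorDim_lt_one
  simpa using hausdorffMeasure_of_dimH_lt this

/-! ### Interior and boundary of K -/

/-- As K ⊆ [0, 5/3], other translates miss (-1/3, 2), an open neighbourhood of K. -/
theorem mem_or_sub_one_or_add_one_mem {x : ℝ} (h0 : -(1 / 3) < x) (h1 : x < 2) :
    x ∈ guthrieNymann ∨ x - 1 ∈ guthrieNymann ∨ x + 1 ∈ guthrieNymann := by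
  obtain ⟨j, hj⟩ := exists_sub_intCast_mem_guthrieNymann x
  have hI := guthrieNymann_subset_Icc hj
  have hj1 : (j : ℝ) < 2 := by linarith [hI.1]
  have hj2 : (-2 : ℝ) < j := by linarith [hI.2]
  have hj1' : j < 2 := by exact_mod_cast hj1
  have hj2' : -2 < j := by exact_mod_cast hj2
  obtain rfl | rfl | rfl : j = 0 ∨ j = 1 ∨ j = -1 := by omega
  · exact Or.inl (by simpa using hj)
  · exact Or.inr (Or.inl (by simpa using hj))
  · exact Or.inr (Or.inr (by simpa using hj))

theorem Ioo_subset_guthrieNymann : Ioo (2 / 3) 1 ⊆ guthrieNymann := by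
  intro x hx
  rcases mem_or_sub_one_or_add_one_mem (x := x) (by linarith [hx.1]) (by linarith [hx.2]) with h | h | h
  · exact h
  · linarith [(guthrieNymann_subset_Icc h).1, hx.2]
  · linarith [(guthrieNymann_subset_Icc h).2, hx.1]

/-- The contractions z ↦ (z + d) / 4 carry interior points of K to interior points, with errors
shrinking by 4. -/
theorem guthrieNymann_subset_closure_interior :
    guthrieNymann ⊆ closure (interior guthrieNymann) := by
  have key : ∀ (n : ℕ), ∀ x ∈ guthrieNymann, ∃ y ∈ interior guthrieNymann,
      |x - y| ≤ 2 * (1 / 4) ^ n := by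
    intro n
    induction n with
    | zero =>
      intro x hx
      refine ⟨3 / 4, interior_maximal Ioo_subset_guthrieNymann isOpen_Ioo (by norm_num), ?_⟩
      have := guthrieNymann_subset_Icc hx
      refine abs_le.mpr ⟨?_, ?_⟩ <;> norm_num <;> linarith [this.1, this.2]
    | succ n ih =>
      intro x hx
      obtain ⟨d, hd, h⟩ := mem_guthrieNymann_iff.1 hx
      obtain ⟨y, hy, hxy⟩ := ih _ h
      have hopen : IsOpen ((fun z : ℝ => 4 * z - d) ⁻¹' interior guthrieNymann) :=
        isOpen_interior.preimage (by fun_prop)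
      refine ⟨(y + d) / 4, interior_maximal (fun z hz => ?_) hopen ?_, ?_⟩
      · exact mem_guthrieNymann_iff.2 ⟨d, hd, interior_subset hz⟩
      · change 4 * ((y + d) / 4) - d ∈ interior guthrieNymann
        exact mem_of_eq_of_mem (by ring) hy
      · rw [pow_succ]
        have := abs_le.mp hxy
        exact abs_le.mpr ⟨by linarith, by linarith⟩
  intro x hx
  refine Metric.mem_closure_iff.2 fun δ hδ => ?_
  obtain ⟨n, hn⟩ := exists_pow_lt_of_lt_one (half_pos hδ) (by norm_num : (1 / 4 : ℝ) < 1)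
  obtain ⟨y, hy, hxy⟩ := key n x hx
  exact ⟨y, hy, by rw [Real.dist_eq]; linarith⟩

theorem volume_inter_translate_pos {x t : ℝ} (hx : x ∈ interior guthrieNymann)
    (ht : x - t ∈ guthrieNymann) :
    0 < volume {y | y ∈ guthrieNymann ∧ y - t ∈ guthrieNymann} := by
  have hopen : IsOpen ((fun y : ℝ => y + t) ⁻¹' interior guthrieNymann) :=
    isOpen_interior.preimage (by fun_prop)
  obtain ⟨y, hy, hyI⟩ := mem_closure_iff.1 (guthrieNymann_subset_closure_interior ht) _ hopen
    (by simpa using hx)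
  have hopen' : IsOpen (interior guthrieNymann ∩ (fun y : ℝ => y - t) ⁻¹' interior guthrieNymann) :=
    isOpen_interior.inter (isOpen_interior.preimage (by fun_prop))
  refine (hopen'.measure_pos volume ⟨y + t, hy, by simpa using hyI⟩).trans_le (measure_mono ?_)
  exact fun z hz => ⟨interior_subset hz.1, interior_subset hz.2⟩

theorem cantor_subset_frontier : digitSums {0, 1, 2} ⊆ frontier guthrieNymann := by
  intro x hx
  have hx' := mem_cantor_iff.1 hx
  refine ⟨subset_closure hx'.1, fun hint => ?_⟩
  refine (volume_inter_translate_pos (t := -1) hint (by simpa using hx'.2)).ne' ?_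
  refine measure_mono_null (fun y hy => mem_cantor_iff.2 ⟨hy.1, ?_⟩) volume_cantor
  simpa using hy.2

theorem frontier_subset_cantor_union :
    frontier guthrieNymann ⊆ digitSums {0, 1, 2} ∪ (fun x => x + 1) '' digitSums {0, 1, 2} := by
  intro x hx
  rw [isClosed_guthrieNymann.frontier_eq] at hx
  obtain ⟨hxK, hxi⟩ := hx
  by_contra hcon
  refine hxi ?_
  have hsub : x + 1 ∉ guthrieNymann := fun h => hcon (Or.inl (mem_cantor_iff.2 ⟨hxK, h⟩))
  have hadd : x - 1 ∉ guthrieNymann := fun h =>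
    hcon (Or.inr ⟨x - 1, mem_cantor_iff.2 ⟨h, by simpa using hxK⟩, by simp⟩)
  have hopen : IsOpen (Ioo (-(1 / 3) : ℝ) 2 ∩ ((fun y : ℝ => y - 1) ⁻¹' guthrieNymannᶜ ∩
      (fun y : ℝ => y + 1) ⁻¹' guthrieNymannᶜ)) :=
    isOpen_Ioo.inter ((isClosed_guthrieNymann.isOpen_compl.preimage (by fun_prop)).inter
      (isClosed_guthrieNymann.isOpen_compl.preimage (by fun_prop)))
  have hxI := guthrieNymann_subset_Icc hxK
  refine interior_maximal ?_ hopen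
    ⟨⟨by linarith [hxI.1], by linarith [hxI.2]⟩, hadd, hsub⟩
  rintro y ⟨hy, hy1, hy2⟩
  rcases mem_or_sub_one_or_add_one_mem hy.1 hy.2 with h | h | h
  · exact h
  · exact absurd h hy1
  · exact absurd h hy2

theorem dimH_frontier_guthrieNymann : dimH (frontier guthrieNymann) = cantorDim := by
  refine le_antisymm ?_ (dimH_cantor ▸ dimH_mono cantor_subset_frontier)
  refine (dimH_mono frontier_subset_cantor_union).trans ?_
  rw [dimH_union, (isometry_add_right (1 : ℝ)).dimH_image, max_self, dimH_cantor]

/-! ### Lebesgue measure and conclusion -/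

theorem volume_guthrieNymann : volume guthrieNymann = 1 := by
  have hm : MeasurableSet guthrieNymann := isClosed_guthrieNymann.measurableSet
  have hsplit : guthrieNymann = guthrieNymann ∩ Ico 0 1 ∪ guthrieNymann ∩ Ico 1 2 := by
    rw [← inter_union_distrib_left, Ico_union_Ico_eq_Ico (by norm_num) (by norm_num)]
    refine (inter_eq_left.2 fun x hx => ?_).symm
    have := guthrieNymann_subset_Icc hx
    exact ⟨this.1, by linarith [this.2]⟩
  have hdisj : Disjoint (guthrieNymann ∩ Ico 0 1) (guthrieNymann ∩ Ico 1 2) :=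
    disjoint_left.2 fun x hx hx' => absurd hx.2.2 (not_lt.2 hx'.2.1)
  have hshift : volume (guthrieNymann ∩ Ico 1 2) =
      volume ((fun x : ℝ => x + 1) ⁻¹' (guthrieNymann ∩ Ico 1 2)) :=
    (measure_preimage_add_right volume 1 _).symm
  -- Moving the part of K beyond 1 back by 1 fills [0, 1); the overlap lies in C.
  have hunion : Ico (0 : ℝ) 1 =
      guthrieNymann ∩ Ico 0 1 ∪ (fun x : ℝ => x + 1) ⁻¹' (guthrieNymann ∩ Ico 1 2) := by
    ext x
    constructor
    · intro hx
      rcases mem_or_sub_one_or_add_one_mem (x := x) (by linarith [hx.1]) (by linarith [hx.2]) with h | h | h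
      · exact Or.inl ⟨h, hx⟩
      · linarith [(guthrieNymann_subset_Icc h).1, hx.2]
      · exact Or.inr ⟨h, by linarith [hx.1], by linarith [hx.2]⟩
    · rintro (hx | hx)
      · exact hx.2
      · exact ⟨by linarith [hx.2.1], by linarith [hx.2.2]⟩
  have hnull : AEDisjoint volume (guthrieNymann ∩ Ico 0 1)
      ((fun x : ℝ => x + 1) ⁻¹' (guthrieNymann ∩ Ico 1 2)) :=
    measure_mono_null (fun x hx => mem_cantor_iff.2 ⟨hx.1.1, hx.2.1⟩) volume_cantor
  have hm2 : MeasurableSet ((fun x : ℝ => x + 1) ⁻¹' (guthrieNymann ∩ Ico 1 2)) :=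
    (hm.inter measurableSet_Ico).preimage (measurable_id.add_const 1)
  rw [hsplit, measure_union hdisj (hm.inter measurableSet_Ico), hshift,
    ← measure_union₀ hm2.nullMeasurableSet hnull, ← hunion]
  simp

theorem mainTheorem5 :
    MeasureTheory.volume guthrieNymann = 1 ∧
      dimH (frontier guthrieNymann) = ENNReal.ofReal (Real.log 3 / Real.log 4) ∧
      ∀ n : ℕ, dimH (frontier guthrieNymann) ≠ (n : ENNReal) := by
  refine ⟨volume_guthrieNymann, ?_, fun n hn => ?_⟩
  · rw [dimH_frontier_guthrieNymann, ← ENNReal.ofReal_coe_nnreal]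
    rfl
  · rw [dimH_frontier_guthrieNymann] at hn
    have h : cantorDim = n := by exact_mod_cast hn
    have h0 := cantorDim_pos
    have h1 := cantorDim_lt_one
    rw [h] at h0 h1
    have h0' : 0 < n := by exact_mod_cast h0
    have h1' : n < 1 := by exact_mod_cast h1
    omega
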